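/- Let $\omega_1,\omega_2,\dots$ be positive real numbers, and suppose that there are $0<\alpha<1$ and $n_0\in\mathbb N$ such that $\omega_n<\alpha\,\omega_{n+1}$ for all $n\ge n_0$, $n\ge 1$. For $m\ge 0$ let $X_m$ be the symmetric tridiagonal $(m+1)\times(m+1)$ matrix with zero diagonal and with off-diagonal entries $\sqrt{\omega_1},\dots,\sqrt{\omega_m}$, and let $G_m(i)$ be the upper-left entry of $(i-X_m)^{-1}$. Put $B_{-1}=B_0=1$ and $B_m=B_{m-1}+\omega_mB_{m-2}$ for $m\ge1$, and put $C_0=1$ and $C_m=\dfrac1{1+\omega_mC_{m-1}}$ for $m\ge1$. The sequence $\{\omega_n\}$ is said to have property (SC) if the following conditions, which are equivalent to one another, hold: (1) the limits $G_{\rm even}=\lim_mG_{2m}(i)$ and $G_{\rm odd}=\lim_mG_{2m+1}(i)$ exist and are different; (2) $\lim_m\prod_{n=1}^m\bigl(1-B_{n-1}/B_n\bigr)$ exists and is positive; (3) $\sum_{n\ge1}B_{n-1}/B_n<\infty$. Then: (a) $C_n$ decays geometrically: there is $K>0$ with $0<C_n\le K\alpha^{n/2}$ for all $n\ge 0$.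 (b) $\{\omega_n\}$ has property (SC), that is, (1), (2) and (3) all hold. (c) The probability measure corresponding to $\{\omega_n\}$ is not unique: there are two different symmetric probability measures on $\mathbb R$ with finite moments of all orders, both of which have Jacobi sequence $\{\omega_n\}$. Here a symmetric probability measure $\mu$ with finite moments of all orders has Jacobi sequence $\{\omega_n\}$ if its monic orthogonal polynomials $P_n$ ($\deg P_n=n$) satisfy $xP_n(x)=P_{n+1}(x)+\omega_nP_{n-1}(x)$ for all $n\ge0$, where $\omega_0P_{-1}$ is read as $0$. -/

import Mathlib

open Filter Topology MeasureTheory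

noncomputable section

/- A Jacobi sequence is indexed as `ω 1, ω 2, …`; the value `ω 0` is never used. -/

/-- The tridiagonal `(m + 1) × (m + 1)` matrix `X_m` with zero diagonal and with off-diagonal
entries `√ω₁, …, √ω_m`. -/
def jacobiMatrix (ω : ℕ → ℝ) (m : ℕ) : Matrix (Fin (m + 1)) (Fin (m + 1)) ℂ :=
  Matrix.of fun j k =>
    if (j : ℕ) + 1 = (k : ℕ) then ((Real.sqrt (ω k) : ℝ) : ℂ)
    else if (k : ℕ) + 1 = (j : ℕ) then ((Real.sqrt (ω j) : ℝ) : ℂ)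
    else 0

/-- The Stieltjes transform `G_m(i)` of `X_m` at `i` with respect to the state `⟨· δ₀, δ₀⟩`:
the upper left entry of `(i - X_m)⁻¹` (the matrix is invertible since `X_m` is Hermitian). -/
def stieltjesAtI (ω : ℕ → ℝ) (m : ℕ) : ℂ :=
  ((Matrix.scalar (Fin (m + 1)) Complex.I - jacobiMatrix ω m)⁻¹) 0 0

/-- The sequence `B_m = B_{m-1} + ω_m B_{m-2}` with `B_{-1} = B_0 = 1`, for `m ≥ 0`. -/
def seqB (ω : ℕ → ℝ) : ℕ → ℝ
  | 0 => 1
  | 1 => 1 + ω 1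
  | m + 2 => seqB ω (m + 1) + ω (m + 2) * seqB ω m

/-- The continued fractions `C_m = 1/(1 + ω_m/(1 + ω_{m-1}/(⋯/(1 + ω_1))))`, with `C_0 = 1`. -/
def seqC (ω : ℕ → ℝ) : ℕ → ℝ
  | 0 => 1
  | m + 1 => 1 / (1 + ω (m + 1) * seqC ω m)

/-- The limits `G_even` of `G_{2m}(i)` and `G_odd` of `G_{2m+1}(i)` exist and are different. -/
def SeparatelyConverges (ω : ℕ → ℝ) : Prop :=
  ∃ Geven Godd : ℂ,
    Tendsto (fun m => stieltjesAtI ω (2 * m)) atTop (𝓝 Geven) ∧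
    Tendsto (fun m => stieltjesAtI ω (2 * m + 1)) atTop (𝓝 Godd) ∧
    Geven ≠ Godd

/-- The partial products of `1 - B_{n-1} / B_n`, `n ≥ 1`, have a positive limit. -/
def HasPositiveProduct (ω : ℕ → ℝ) : Prop :=
  ∃ L : ℝ, 0 < L ∧
    Tendsto (fun m : ℕ => ∏ n ∈ Finset.Icc 1 m, (1 - seqB ω (n - 1) / seqB ω n)) atTop (𝓝 L)

/-- The partial sums of `B_{n-1} / B_n`, `n ≥ 1`, have a finite limit. -/
def HasFiniteSum (ω : ℕ → ℝ) : Prop :=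
  ∃ S : ℝ,
    Tendsto (fun m : ℕ => ∑ n ∈ Finset.Icc 1 m, seqB ω (n - 1) / seqB ω n) atTop (𝓝 S)

/-- Property (SC). It is usually defined by any one of these three conditions, which are
equivalent for positive sequences; here all of them are required. -/
def PropertySC (ω : ℕ → ℝ) : Prop :=
  SeparatelyConverges ω ∧ HasPositiveProduct ω ∧ HasFiniteSum ω

/-- `P` is the sequence of monic orthogonal polynomials of `μ`. -/
def IsMonicOrthogonal (μ : Measure ℝ) (P : ℕ → Polynomial ℝ) : Prop :=
  (∀ n, (P n).Monic ∧ (P n).natDegree = n) ∧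
  ∀ m n, m ≠ n → ∫ x, (P m).eval x * (P n).eval x ∂μ = 0

/-- `μ` is a symmetric probability measure on `ℝ` with finite moments of all orders, and its
Jacobi sequence is `ω`: its monic orthogonal polynomials satisfy
`x P_n = P_{n+1} + ω_n P_{n-1}` for `n ≥ 0`, where `P_{-1} = 0`. -/
structure IsSymmetricWithJacobi (ω : ℕ → ℝ) (μ : Measure ℝ) : Prop where
  prob : IsProbabilityMeasure μ
  symm : μ.map (fun x : ℝ => -x) = μ
  moments : ∀ n : ℕ, Integrable (fun x : ℝ => x ^ n) μ
  jacobi : ∃ P : ℕ → Polynomial ℝ, IsMonicOrthogonal μ P ∧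
    Polynomial.X * P 0 = P 1 ∧
    ∀ n, Polynomial.X * P (n + 1) = P (n + 2) + Polynomial.C (ω (n + 1)) * P n

end

/-! The recurrence for `B` is governed by its two-step part `ω_m B_{m-2}`. Let `W_m = ω_m ω_{m-2} ⋯`
and `E_m = B_m / W_m`. Then `E_{m+2} = E_m + E_{m+1} W_{m+1} / W_{m+2}`, and the growth of `ω` makes
`W_m / W_{m+1}` of order `α^{m/2}`. Hence `E` is bounded (`seqB_div_stepProd_le`), which gives the
decay of `C` and, through `∏_{n ≤ m+1} (1 - B_{n-1}/B_n) = 1 / (E_{m+1} E_m)`, a positive limit of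
the products.

With `A_m` the numerators of the convergents, `G_m(i) = -i A_m / B_m` (`stieltjesAtI_eq`).
Consecutive convergents differ by plus or minus the partial product, so the even and odd ones have
different limits.

Moreover `A_m / B_m = ∫ 1/(1+x²) dμ_m`, where `μ_m` is the spectral measure of `X_m` at `e_0`. Each
moment of `μ_m` is constant for large `m`, so tightness yields weak limit points that keep all
moments (`exists_limit_measure`). Limit points along even and odd indices, symmetrized, have the
same Jacobi sequence but different integrals of `1/(1+x²)`. -/

noncomputable section

/-- The numerators of the convergents `A_m / B_m`, with `A_{-1} = 0`, `A_0 = 1` and the same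
recurrence as `seqB`. -/
def seqA (ω : ℕ → ℝ) : ℕ → ℝ
  | 0 => 1
  | 1 => 1
  | m + 2 => seqA ω (m + 1) + ω (m + 2) * seqA ω m

/-- The products `W_m = ω_m ω_{m-2} ω_{m-4} ⋯`. -/
def stepProd (ω : ℕ → ℝ) : ℕ → ℝ
  | 0 => 1
  | 1 => ω 1
  | m + 2 => ω (m + 2) * stepProd ω m

/-! ### Growth of the denominators, partial products and convergents -/

section Sequences

variable {ω : ℕ → ℝ}

lemma seqB_pos (hpos : ∀ n, 1 ≤ n → 0 < ω n) : ∀ n, 0 < seqB ω n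
  | 0 => by simp [seqB]
  | 1 => by have := hpos 1 le_rfl; simp only [seqB]; linarith
  | n + 2 => by
    have h1 := seqB_pos hpos (n + 1)
    have h0 := seqB_pos hpos n
    have := hpos (n + 2) (by omega)
    simp only [seqB]; positivity

lemma stepProd_pos (hpos : ∀ n, 1 ≤ n → 0 < ω n) : ∀ n, 0 < stepProd ω n
  | 0 => by simp [stepProd]
  | 1 => hpos 1 le_rfl
  | n + 2 => by
    have h0 := stepProd_pos hpos n
    have := hpos (n + 2) (by omega)
    simp only [stepProd]; positivity

lemma seqC_succ (hpos : ∀ n, 1 ≤ n → 0 < ω n) :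
    ∀ n, seqC ω (n + 1) = seqB ω n / seqB ω (n + 1)
  | 0 => by simp [seqC, seqB]
  | n + 1 => by
    have h0 := seqB_pos hpos n
    have h1 := seqB_pos hpos (n + 1)
    have h2 := seqB_pos hpos (n + 2)
    rw [seqC, seqC_succ hpos n]
    simp only [seqB] at h2 ⊢
    field_simp

lemma seqC_pos (hpos : ∀ n, 1 ≤ n → 0 < ω n) : ∀ n, 0 < seqC ω n
  | 0 => by simp [seqC]
  | n + 1 => by
    rw [seqC_succ hpos]; exact div_pos (seqB_pos hpos _) (seqB_pos hpos _)

lemma seqC_succ_lt_one (hpos : ∀ n, 1 ≤ n → 0 < ω n) (n : ℕ) : seqC ω (n + 1) < 1 := by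
  have h0 := seqC_pos hpos n
  have h1 := hpos (n + 1) (by omega)
  rw [seqC, div_lt_one (by positivity)]
  nlinarith [mul_pos h1 h0]

/-- Steps of two keep parity, so the values below `N + 2` control both parity classes. -/
lemma bddAbove_of_eventually_step_le {σ : ℕ → ℝ} {N : ℕ}
    (h : ∀ m, N ≤ m → σ (m + 2) ≤ σ m) : ∃ K, 0 < K ∧ ∀ m, σ m ≤ K := by
  obtain ⟨K, hK⟩ := ((Finset.range (N + 2)).image σ).bddAbove
  have hK' : ∀ m, m < N + 2 → σ m ≤ max K 1 := fun m hm =>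
    (hK (Finset.mem_coe.2 (Finset.mem_image_of_mem _ (Finset.mem_range.2 hm)))).trans
      (le_max_left _ _)
  refine ⟨max K 1, by positivity, fun m => ?_⟩
  induction m using Nat.strong_induction_on with
  | _ m ih =>
    by_cases hm : m < N + 2
    · exact hK' m hm
    · obtain ⟨k, rfl⟩ : ∃ k, m = k + 2 := ⟨m - 2, by omega⟩
      exact (h k (by omega)).trans (ih k (by omega))

/-- Moving `m` to `m + 2` multiplies the ratio by `ω_{m+2} / ω_{m+3} < α`, that is, by less than
`√α` per index on average. -/
lemma stepProd_ratio_le (hpos : ∀ n, 1 ≤ n → 0 < ω n) {α : ℝ} (hα0 : 0 < α) {n₀ : ℕ}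
    (hω : ∀ n, 1 ≤ n → n₀ ≤ n → ω n < α * ω (n + 1)) :
    ∃ K, 0 < K ∧ ∀ m, stepProd ω m / stepProd ω (m + 1) ≤ K * Real.sqrt α ^ (m + 1) := by
  have hs : 0 < Real.sqrt α := Real.sqrt_pos.2 hα0
  obtain ⟨K, hK0, hK⟩ := bddAbove_of_eventually_step_le
    (σ := fun m => stepProd ω m / stepProd ω (m + 1) / Real.sqrt α ^ (m + 1)) (N := n₀) (by
      intro m hm
      have h0 := stepProd_pos hpos m
      have h1 := stepProd_pos hpos (m + 1)
      have w2 := hpos (m + 2) (by omega)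
      have w3 := hpos (m + 3) (by omega)
      have hlt := hω (m + 2) (by omega) (by omega)
      have e : Real.sqrt α ^ (m + 2 + 1) = Real.sqrt α ^ (m + 1) * α := by
        rw [show m + 2 + 1 = m + 1 + 2 by ring, pow_add, Real.sq_sqrt hα0.le]
      simp only [stepProd]
      rw [e, div_div, div_div, div_le_div_iff₀ (by positivity) (by positivity)]
      have hp : 0 < stepProd ω m * (stepProd ω (m + 1) * Real.sqrt α ^ (m + 1)) := by positivity
      nlinarith [mul_lt_mul_of_pos_left hlt hp])
  exact ⟨K, hK0, fun m => (div_le_iff₀ (by positivity)).1 (hK m)⟩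

lemma seqB_div_stepProd_step (hpos : ∀ n, 1 ≤ n → 0 < ω n) (m : ℕ) :
    seqB ω (m + 2) / stepProd ω (m + 2) = seqB ω m / stepProd ω m +
      seqB ω (m + 1) / stepProd ω (m + 1) * (stepProd ω (m + 1) / stepProd ω (m + 2)) := by
  have h0 := stepProd_pos hpos m
  have h1 := stepProd_pos hpos (m + 1)
  have w2 := hpos (m + 2) (by omega)
  simp only [stepProd, seqB]
  field_simp
  ring

lemma one_le_seqB_div_stepProd (hpos : ∀ n, 1 ≤ n → 0 < ω n) :
    ∀ m, 1 ≤ seqB ω m / stepProd ω m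
  | 0 => by simp [seqB, stepProd]
  | 1 => by
    have := hpos 1 le_rfl
    simp only [seqB, stepProd]
    rw [le_div_iff₀ this]; linarith
  | m + 2 => by
    have h := one_le_seqB_div_stepProd hpos m
    have h0 := stepProd_pos hpos (m + 1)
    have h1 := stepProd_pos hpos (m + 2)
    have h2 := seqB_pos hpos (m + 1)
    rw [seqB_div_stepProd_step hpos]
    have : 0 < seqB ω (m + 1) / stepProd ω (m + 1) *
      (stepProd ω (m + 1) / stepProd ω (m + 2)) := by positivity
    linarith

/-- A discrete Grönwall argument: `max (E m) (E (m + 1))` grows at each step by a factor of at most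
`1 + r m ≤ exp (r m)`, and `r` is summable. -/
lemma seqB_div_stepProd_le (hpos : ∀ n, 1 ≤ n → 0 < ω n) {α : ℝ} (hα0 : 0 < α) (hα1 : α < 1)
    {n₀ : ℕ} (hω : ∀ n, 1 ≤ n → n₀ ≤ n → ω n < α * ω (n + 1)) :
    ∃ T, ∀ m, seqB ω m / stepProd ω m ≤ T := by
  obtain ⟨K, hK0, hK⟩ := stepProd_ratio_le hpos hα0 hω
  have hs0 : 0 ≤ Real.sqrt α := Real.sqrt_nonneg α
  have hs1 : Real.sqrt α < 1 := by rw [Real.sqrt_lt' one_pos]; simpa using hα1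
  set E : ℕ → ℝ := fun m => seqB ω m / stepProd ω m with hE
  have hE1 : ∀ m, 1 ≤ E m := one_le_seqB_div_stepProd hpos
  set r : ℕ → ℝ := fun m => K * Real.sqrt α ^ m with hr
  have hr0 : ∀ m, 0 ≤ r m := fun m => by positivity
  have hsum : Summable r := (summable_geometric_of_lt_one hs0 hs1).mul_left K
  have hstep : ∀ m, E (m + 2) ≤ E m + E (m + 1) * r m := by
    intro m
    have h := seqB_div_stepProd_step hpos m
    have h' : stepProd ω (m + 1) / stepProd ω (m + 2) ≤ r m := by
      refine (hK (m + 1)).trans ?_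
      exact mul_le_mul_of_nonneg_left (pow_le_pow_of_le_one hs0 hs1.le (by omega)) hK0.le
    calc E (m + 2) = E m + E (m + 1) * (stepProd ω (m + 1) / stepProd ω (m + 2)) := h
      _ ≤ _ := by gcongr; linarith [hE1 (m + 1)]
  have hmax : ∀ m, max (E m) (E (m + 1)) ≤
      max (E 0) (E 1) * Real.exp (∑ k ∈ Finset.range m, r k) := by
    intro m
    induction m with
    | zero => simp
    | succ m ih =>
      rw [Finset.sum_range_succ, Real.exp_add, ← mul_assoc]
      have h1 : max (E (m + 1)) (E (m + 2)) ≤ max (E m) (E (m + 1)) * (1 + r m) := by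
        have hm0 : 1 ≤ max (E m) (E (m + 1)) := (hE1 m).trans (le_max_left _ _)
        have := hr0 m
        apply max_le
        · nlinarith [le_max_right (E m) (E (m + 1))]
        · have a := le_max_left (E m) (E (m + 1))
          have b := le_max_right (E m) (E (m + 1))
          nlinarith [hstep m, mul_le_mul_of_nonneg_right b this]
      refine h1.trans (mul_le_mul ih ?_ (by linarith [hr0 m]) ?_)
      · linarith [Real.add_one_le_exp (r m)]
      · exact mul_nonneg (le_trans (by linarith [hE1 0]) (le_max_left _ _)) (Real.exp_pos _).le
  refine ⟨max (E 0) (E 1) * Real.exp (∑' k, r k), fun m => ?_⟩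
  refine (le_max_left _ _).trans ((hmax m).trans ?_)
  have : 0 ≤ max (E 0) (E 1) := le_trans (by linarith [hE1 0]) (le_max_left _ _)
  gcongr
  exact hsum.sum_le_tsum _ (fun i _ => hr0 i)

lemma seqC_le_geometric (hpos : ∀ n, 1 ≤ n → 0 < ω n) {α : ℝ} (hα0 : 0 < α) (hα1 : α < 1)
    {n₀ : ℕ} (hω : ∀ n, 1 ≤ n → n₀ ≤ n → ω n < α * ω (n + 1)) :
    ∃ K : ℝ, 0 < K ∧ ∀ n, seqC ω n ≤ K * Real.sqrt α ^ n := by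
  obtain ⟨K, hK0, hK⟩ := stepProd_ratio_le hpos hα0 hω
  obtain ⟨T, hT⟩ := seqB_div_stepProd_le hpos hα0 hα1 hω
  have hs : 0 < Real.sqrt α := Real.sqrt_pos.2 hα0
  have hT1 : 1 ≤ T := (one_le_seqB_div_stepProd hpos 0).trans (hT 0)
  refine ⟨max 1 (T * K), by positivity, fun n => ?_⟩
  cases n with
  | zero => simp [seqC]
  | succ n =>
    have h0 := stepProd_pos hpos n
    have h1 := stepProd_pos hpos (n + 1)
    have b0 := seqB_pos hpos n
    have b1 := seqB_pos hpos (n + 1)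
    have hE := one_le_seqB_div_stepProd hpos (n + 1)
    rw [one_le_div h1] at hE
    calc seqC ω (n + 1) = seqB ω n / seqB ω (n + 1) := seqC_succ hpos n
      -- Uses `W_{n+1} ≤ B_{n+1}`, which is `1 ≤ E_{n+1}`.
      _ ≤ seqB ω n / stepProd ω (n + 1) := by gcongr
      _ = seqB ω n / stepProd ω n * (stepProd ω n / stepProd ω (n + 1)) := by field_simp
      _ ≤ T * (K * Real.sqrt α ^ (n + 1)) := by
        gcongr
        · exact hT n
        · exact hK n
      _ ≤ _ := by
        rw [← mul_assoc]
        gcongr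
        exact le_max_right _ _

lemma hasFiniteSum_of_summable (hpos : ∀ n, 1 ≤ n → 0 < ω n) (h : Summable (seqC ω)) :
    HasFiniteSum ω := by
  refine ⟨_, ((summable_nat_add_iff 1).2 h).hasSum.tendsto_sum_nat.congr fun m => ?_⟩
  induction m with
  | zero => simp
  | succ m ih =>
    rw [Finset.sum_range_succ, ih, Finset.sum_Icc_succ_top (by omega), seqC_succ hpos]
    simp

/-- The partial products of `1 - B_{n-1} / B_n`. -/
def partialProd (ω : ℕ → ℝ) (m : ℕ) : ℝ :=
  ∏ n ∈ Finset.Icc 1 m, (1 - seqB ω (n - 1) / seqB ω n)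

lemma partialProd_succ (hpos : ∀ n, 1 ≤ n → 0 < ω n) (m : ℕ) :
    partialProd ω (m + 1) = partialProd ω m * (1 - seqC ω (m + 1)) := by
  rw [partialProd, Finset.prod_Icc_succ_top (by omega), seqC_succ hpos]
  simp [partialProd]

lemma partialProd_pos (hpos : ∀ n, 1 ≤ n → 0 < ω n) (m : ℕ) : 0 < partialProd ω m := by
  induction m with
  | zero => simp [partialProd]
  | succ m ih =>
    rw [partialProd_succ hpos]
    exact mul_pos ih (by linarith [seqC_succ_lt_one hpos m])

lemma partialProd_antitone (hpos : ∀ n, 1 ≤ n → 0 < ω n) : Antitone (partialProd ω) := by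
  refine antitone_nat_of_succ_le fun m => ?_
  rw [partialProd_succ hpos]
  nlinarith [partialProd_pos hpos m, seqC_pos hpos (m + 1)]

/-- For `n ≥ 2` the factor is `ω_n B_{n-2} / B_n = E_{n-2} / E_n`, so the product telescopes in
steps of two. -/
lemma partialProd_succ_eq (hpos : ∀ n, 1 ≤ n → 0 < ω n) (m : ℕ) :
    partialProd ω (m + 1) =
      1 / (seqB ω (m + 1) / stepProd ω (m + 1) * (seqB ω m / stepProd ω m)) := by
  induction m with
  | zero =>
    have := hpos 1 le_rfl
    simp only [partialProd, seqB, stepProd]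
    simp [seqB]
    field_simp
    ring
  | succ m ih =>
    have h0 := stepProd_pos hpos m
    have h1 := stepProd_pos hpos (m + 1)
    have b0 := seqB_pos hpos m
    have b1 := seqB_pos hpos (m + 1)
    have b2 := seqB_pos hpos (m + 2)
    have w2 := hpos (m + 2) (by omega)
    rw [partialProd_succ hpos, ih, seqC_succ hpos]
    simp only [stepProd, seqB] at b2 ⊢
    field_simp
    ring

lemma partialProd_tendsto (hpos : ∀ n, 1 ≤ n → 0 < ω n) {T : ℝ}
    (hT : ∀ m, seqB ω m / stepProd ω m ≤ T) :
    ∃ L : ℝ, 0 < L ∧ Tendsto (partialProd ω) atTop (𝓝 L) := by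
  have hT1 : 1 ≤ T := (one_le_seqB_div_stepProd hpos 0).trans (hT 0)
  have hlow : ∀ m, 1 / (T * T) ≤ partialProd ω m := by
    intro m
    refine le_trans ?_ (partialProd_antitone hpos (Nat.le_succ m))
    rw [partialProd_succ_eq hpos]
    have e0 := one_le_seqB_div_stepProd hpos m
    have e1 := one_le_seqB_div_stepProd hpos (m + 1)
    have := hT m
    have := hT (m + 1)
    have : 0 < seqB ω (m + 1) / stepProd ω (m + 1) * (seqB ω m / stepProd ω m) := by positivity
    gcongr
  have hbdd : BddBelow (Set.range (partialProd ω)) := ⟨_, Set.forall_mem_range.2 hlow⟩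
  have ht := tendsto_atTop_ciInf (partialProd_antitone hpos) hbdd
  exact ⟨_, lt_of_lt_of_le (by positivity) (ge_of_tendsto' ht hlow), ht⟩

lemma seqA_pos (hpos : ∀ n, 1 ≤ n → 0 < ω n) : ∀ n, 0 < seqA ω n
  | 0 => by simp [seqA]
  | 1 => by simp [seqA]
  | n + 2 => by
    have h1 := seqA_pos hpos (n + 1)
    have h0 := seqA_pos hpos n
    have := hpos (n + 2) (by omega)
    simp only [seqA]; positivity

/-- The determinant formula for continued fractions: each difference is the previous one times
`-ω_{m+2} B_m / B_{m+2} = -(1 - C_{m+2})`. -/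
lemma convergent_succ_sub (hpos : ∀ n, 1 ≤ n → 0 < ω n) (m : ℕ) :
    seqA ω (m + 1) / seqB ω (m + 1) - seqA ω m / seqB ω m =
      (-1) ^ (m + 1) * partialProd ω (m + 1) := by
  induction m with
  | zero =>
    have := hpos 1 le_rfl
    simp [partialProd, seqA, seqB]
  | succ m ih =>
    have b0 := seqB_pos hpos m
    have b1 := seqB_pos hpos (m + 1)
    have b2 := seqB_pos hpos (m + 2)
    have key : seqA ω (m + 2) / seqB ω (m + 2) - seqA ω (m + 1) / seqB ω (m + 1) =
        -(1 - seqC ω (m + 2)) * (seqA ω (m + 1) / seqB ω (m + 1) - seqA ω m / seqB ω m) := by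
      rw [seqC_succ hpos]
      simp only [seqA, seqB] at b2 ⊢
      field_simp
      ring
    rw [key, ih, partialProd_succ hpos (m + 1)]
    ring

/-- The even convergents decrease and are positive; the odd ones lie below them by a partial
product, so the limits differ by `L`. -/
lemma convergents_tendsto (hpos : ∀ n, 1 ≤ n → 0 < ω n) {L : ℝ} (hL0 : 0 < L)
    (hL : Tendsto (partialProd ω) atTop (𝓝 L)) :
    ∃ s t : ℝ, Tendsto (fun m => seqA ω (2 * m) / seqB ω (2 * m)) atTop (𝓝 s) ∧
      Tendsto (fun m => seqA ω (2 * m + 1) / seqB ω (2 * m + 1)) atTop (𝓝 t) ∧ s ≠ t := by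
  have hodd : ∀ m, seqA ω (2 * m + 1) / seqB ω (2 * m + 1) =
      seqA ω (2 * m) / seqB ω (2 * m) - partialProd ω (2 * m + 1) := by
    intro m
    have h := convergent_succ_sub hpos (2 * m)
    rw [(odd_two_mul_add_one m).neg_one_pow] at h
    linarith
  have hanti : Antitone fun m => seqA ω (2 * m) / seqB ω (2 * m) := by
    refine antitone_nat_of_succ_le fun m => ?_
    have h := convergent_succ_sub hpos (2 * m + 1)
    have he : Even (2 * m + 1 + 1) := ⟨m + 1, by ring⟩
    rw [he.neg_one_pow] at h
    have h2 := partialProd_antitone hpos (Nat.le_succ (2 * m + 1))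
    have h3 := hodd m
    simp only [Nat.succ_eq_add_one] at h2
    rw [show 2 * (m + 1) = 2 * m + 1 + 1 by ring]
    linarith
  have hbdd : BddBelow (Set.range fun m => seqA ω (2 * m) / seqB ω (2 * m)) :=
    ⟨0, Set.forall_mem_range.2 fun m => (div_pos (seqA_pos hpos _) (seqB_pos hpos _)).le⟩
  have hs := tendsto_atTop_ciInf hanti hbdd
  have hmono : Tendsto (fun m : ℕ => 2 * m + 1) atTop atTop :=
    tendsto_atTop_mono (fun m => by simp only [id]; omega) tendsto_id
  refine ⟨_, _, hs, ((hs.sub (hL.comp hmono)).congr fun m => (hodd m).symm), ?_⟩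
  intro h
  linarith

end Sequences

/-! ### The truncated Jacobi matrix and its resolvent at `i` -/

lemma isHermitian_jacobiMatrix (ω : ℕ → ℝ) (m : ℕ) : (jacobiMatrix ω m).IsHermitian := by
  ext j k
  simp only [jacobiMatrix, Matrix.conjTranspose_apply, Matrix.of_apply]
  split_ifs <;> first | omega | simp

open scoped ComplexOrder in
-- The positive definite matrix `1 + A*A` factors as `(i - A) · (-(i + A))`.
lemma Matrix.IsHermitian.isUnit_scalar_I_sub {n : Type*} [Fintype n] [DecidableEq n]
    {A : Matrix n n ℂ} (hA : A.IsHermitian) : IsUnit (Matrix.scalar n Complex.I - A) := by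
  have hpd : (1 + A.conjTranspose * A).PosDef :=
    Matrix.PosDef.one.add_posSemidef (Matrix.posSemidef_conjTranspose_mul_self A)
  have hu := hpd.isUnit
  have hcomm : Matrix.scalar n Complex.I * A = A * Matrix.scalar n Complex.I :=
    (Matrix.scalar_commute _ (fun _ => Commute.all _ _) A).eq
  have hI : Matrix.scalar n Complex.I * Matrix.scalar n Complex.I = -1 := by
    rw [← map_mul, Complex.I_mul_I, map_neg, map_one]
  have he : 1 + A.conjTranspose * A =
      (Matrix.scalar n Complex.I - A) * -(Matrix.scalar n Complex.I + A) := by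
    rw [hA.eq, mul_neg, sub_mul, mul_add, mul_add, hcomm, hI]
    abel
  rw [he, Matrix.isUnit_iff_isUnit_det, Matrix.det_mul] at hu
  rw [Matrix.isUnit_iff_isUnit_det]
  exact isUnit_of_mul_isUnit_left hu

/-- The numbers `√(ω₁ ⋯ ωₙ)`. -/
def sqrtProd (ω : ℕ → ℝ) : ℕ → ℝ
  | 0 => 1
  | n + 1 => sqrtProd ω n * Real.sqrt (ω (n + 1))

/-- The vector `√(ω₁ ⋯ ωₙ) eₙ` of `ℂ^(m+1)`, which is zero for `n > m`. -/
def jacobiVec (ω : ℕ → ℝ) (m n : ℕ) : Fin (m + 1) → ℂ :=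
  fun j => if (j : ℕ) = n then (sqrtProd ω n : ℂ) else 0

section Jacobi

variable {ω : ℕ → ℝ}

lemma jacobiVec_zero (ω : ℕ → ℝ) (m : ℕ) : jacobiVec ω m 0 = Pi.single 0 1 := by
  ext j
  simp only [jacobiVec, sqrtProd, Pi.single_apply, Fin.ext_iff]
  simp

lemma jacobiVec_succ_apply_zero (ω : ℕ → ℝ) (m n : ℕ) : jacobiVec ω m (n + 1) 0 = 0 := by
  simp [jacobiVec]

lemma jacobiMatrix_mulVec_jacobiVec_apply (ω : ℕ → ℝ) {m n : ℕ} (hn : n ≤ m)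
    (j : Fin (m + 1)) :
    (jacobiMatrix ω m).mulVec (jacobiVec ω m n) j =
      if (j : ℕ) + 1 = n then ((Real.sqrt (ω n) * sqrtProd ω n : ℝ) : ℂ)
      else if n + 1 = (j : ℕ) then ((Real.sqrt (ω j) * sqrtProd ω n : ℝ) : ℂ) else 0 := by
  rw [Matrix.mulVec, dotProduct, Finset.sum_eq_single ⟨n, by omega⟩]
  · simp only [jacobiMatrix, jacobiVec, Matrix.of_apply]
    split_ifs <;> simp
  · intro k _ hk
    have : (k : ℕ) ≠ n := fun h => hk (Fin.ext h)
    simp [jacobiVec, this]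
  · simp

lemma jacobiMatrix_mulVec_zero (ω : ℕ → ℝ) (m : ℕ) :
    (jacobiMatrix ω m).mulVec (jacobiVec ω m 0) = jacobiVec ω m 1 := by
  ext j
  rw [jacobiMatrix_mulVec_jacobiVec_apply ω (Nat.zero_le m)]
  by_cases h : (j : ℕ) = 1
  · simp [jacobiVec, h, sqrtProd]
  · simp [jacobiVec, h, Ne.symm h]

/-- The scaling turns the symmetric matrix action into the monic three-term recurrence. For `n + 1 =
m` it still holds, since `jacobiVec ω m (m + 1)` is zero. -/
lemma jacobiMatrix_mulVec_succ (hpos : ∀ n, 1 ≤ n → 0 < ω n) {m n : ℕ} (hn : n + 1 ≤ m) :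
    (jacobiMatrix ω m).mulVec (jacobiVec ω m (n + 1)) =
      jacobiVec ω m (n + 2) + ((ω (n + 1) : ℝ) : ℂ) • jacobiVec ω m n := by
  ext j
  rw [jacobiMatrix_mulVec_jacobiVec_apply ω hn]
  simp only [jacobiVec, Pi.add_apply, Pi.smul_apply, smul_eq_mul]
  by_cases h : (j : ℕ) = n
  · have h2 : ¬ n = n + 2 := by omega
    simp only [h, if_true, if_neg h2, zero_add, sqrtProd]
    rw [← Complex.ofReal_mul]
    congr 1
    have := Real.mul_self_sqrt (hpos (n + 1) (by omega)).le
    linear_combination sqrtProd ω n * this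
  · by_cases h' : (j : ℕ) = n + 2
    · have h2 : ¬ n + 2 + 1 = n + 1 := by omega
      have h3 : ¬ n + 2 = n := by omega
      simp only [h', if_neg h2, if_neg h3, if_true, mul_zero, add_zero]
      rw [mul_comm]; rfl
    · rw [if_neg (by omega), if_neg (by omega), if_neg h', if_neg h]
      simp

/-- At `n = m` the error vector vanishes, so `s` is `i^(m+1) B_m` times the first column of the
resolvent, and its top entry gives `G_m(i)`. -/
lemma exists_resolvent_vec (hpos : ∀ n, 1 ≤ n → 0 < ω n) (m : ℕ) : ∀ n, n ≤ m →
    ∃ s : Fin (m + 1) → ℂ,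
      (Matrix.scalar (Fin (m + 1)) Complex.I - jacobiMatrix ω m).mulVec s =
        (Complex.I ^ (n + 1) * (seqB ω n : ℂ)) • jacobiVec ω m 0 - jacobiVec ω m (n + 1) ∧
      s 0 = Complex.I ^ n * (seqA ω n : ℂ)
  | 0, _ => by
    refine ⟨jacobiVec ω m 0, ?_, ?_⟩
    · rw [Matrix.sub_mulVec, jacobiMatrix_mulVec_zero, Matrix.scalar_apply,
        ← Matrix.smul_one_eq_diagonal, Matrix.smul_mulVec, Matrix.one_mulVec]
      simp [seqB]
    · simp [jacobiVec, seqA, sqrtProd]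
  | 1, h => by
    refine ⟨Complex.I • jacobiVec ω m 0 + jacobiVec ω m 1, ?_, ?_⟩
    · rw [Matrix.sub_mulVec, Matrix.scalar_apply,
        ← Matrix.smul_one_eq_diagonal, Matrix.smul_mulVec, Matrix.one_mulVec, Matrix.mulVec_add,
        Matrix.mulVec_smul, jacobiMatrix_mulVec_zero, jacobiMatrix_mulVec_succ hpos h]
      ext j
      simp only [Pi.sub_apply, Pi.add_apply, Pi.smul_apply, smul_eq_mul, seqB]
      push_cast
      linear_combination (-(ω 1 : ℂ) * jacobiVec ω m 0 j) * Complex.I_mul_I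
    · simp [jacobiVec, seqA, sqrtProd]
  | n + 2, h => by
    obtain ⟨s0, h0, z0⟩ := exists_resolvent_vec hpos m n (by omega)
    obtain ⟨s1, h1, z1⟩ := exists_resolvent_vec hpos m (n + 1) (by omega)
    -- The middle vector cancels the error of `i s1`, and subtracting `ω_{n+2} s0` removes the
    -- `jacobiVec ω m (n + 1)` term this creates.
    refine ⟨Complex.I • s1 + jacobiVec ω m (n + 2) - ((ω (n + 2) : ℝ) : ℂ) • s0, ?_, ?_⟩
    · rw [Matrix.mulVec_sub, Matrix.mulVec_add, Matrix.mulVec_smul, Matrix.mulVec_smul, h0, h1,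
        Matrix.sub_mulVec, Matrix.scalar_apply,
        ← Matrix.smul_one_eq_diagonal, Matrix.smul_mulVec, Matrix.one_mulVec,
        jacobiMatrix_mulVec_succ hpos h]
      ext j
      simp only [Pi.sub_apply, Pi.add_apply, Pi.smul_apply, smul_eq_mul, seqB]
      push_cast
      linear_combination (-(ω (n + 2) : ℂ) * seqB ω n * Complex.I ^ (n + 1) *
        jacobiVec ω m 0 j) * Complex.I_mul_I
    · simp only [Pi.sub_apply, Pi.add_apply, Pi.smul_apply, smul_eq_mul, z0, z1, seqA,
        jacobiVec_succ_apply_zero]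
      push_cast
      linear_combination (-(ω (n + 2) : ℂ) * seqA ω n * Complex.I ^ n) * Complex.I_mul_I

lemma stieltjesAtI_eq (hpos : ∀ n, 1 ≤ n → 0 < ω n) (m : ℕ) :
    stieltjesAtI ω m = -Complex.I * ((seqA ω m / seqB ω m : ℝ) : ℂ) := by
  obtain ⟨s, hs, hs0⟩ := exists_resolvent_vec hpos m m le_rfl
  set N := Matrix.scalar (Fin (m + 1)) Complex.I - jacobiMatrix ω m with hN
  have hlast : jacobiVec ω m (m + 1) = 0 := by
    ext j
    have := j.2
    simp only [jacobiVec, Pi.zero_apply]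
    rw [if_neg (by omega)]
  rw [hlast, sub_zero, jacobiVec_zero] at hs
  have hdet : IsUnit N.det :=
    (Matrix.isUnit_iff_isUnit_det _).1 (isHermitian_jacobiMatrix ω m).isUnit_scalar_I_sub
  have h1 : s = N⁻¹.mulVec ((Complex.I ^ (m + 1) * (seqB ω m : ℂ)) • Pi.single 0 1) := by
    rw [← hs, Matrix.mulVec_mulVec, Matrix.nonsing_inv_mul _ hdet, Matrix.one_mulVec]
  have h2 : s 0 = Complex.I ^ (m + 1) * (seqB ω m : ℂ) * stieltjesAtI ω m := by
    rw [h1, Matrix.mulVec_smul, Matrix.mulVec_single_one]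
    rfl
  have hB : (seqB ω m : ℂ) ≠ 0 := by exact_mod_cast (seqB_pos hpos m).ne'
  have hI : Complex.I ^ m ≠ 0 := pow_ne_zero _ Complex.I_ne_zero
  rw [hs0] at h2
  push_cast
  field_simp
  apply mul_left_cancel₀ hI
  linear_combination Complex.I * h2 +
    (Complex.I ^ m * seqB ω m * stieltjesAtI ω m) * Complex.I_mul_I

/-! ### Monic polynomials of the Jacobi sequence -/

/-- The monic polynomials `P_{n+2} = x P_{n+1} - ω_{n+1} P_n`, `P_0 = 1`, `P_1 = x`. -/
def jacobiPoly (ω : ℕ → ℝ) : ℕ → Polynomial ℝ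
  | 0 => 1
  | 1 => Polynomial.X
  | n + 2 => Polynomial.X * jacobiPoly ω (n + 1) - Polynomial.C (ω (n + 1)) * jacobiPoly ω n

/-- Both sides obey the same recurrence. Consequently `P_n(X_m)` has zero upper left entry for `1 ≤
n ≤ m`. -/
lemma aeval_jacobiPoly_mulVec (hpos : ∀ n, 1 ≤ n → 0 < ω n) (m : ℕ) : ∀ n, n ≤ m →
    (Polynomial.aeval (jacobiMatrix ω m) (jacobiPoly ω n)).mulVec (jacobiVec ω m 0) =
      jacobiVec ω m n
  | 0, _ => by simp [jacobiPoly]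
  | 1, _ => by simp [jacobiPoly, jacobiMatrix_mulVec_zero]
  | n + 2, h => by
    rw [jacobiPoly, map_sub, map_mul, map_mul, Polynomial.aeval_X, Polynomial.aeval_C,
      Matrix.sub_mulVec, ← Matrix.mulVec_mulVec, aeval_jacobiPoly_mulVec hpos m (n + 1) (by omega),
      jacobiMatrix_mulVec_succ hpos (by omega), Algebra.algebraMap_eq_smul_one, smul_mul_assoc,
      one_mul, Matrix.smul_mulVec, aeval_jacobiPoly_mulVec hpos m n (by omega)]
    ext j
    simp

lemma aeval_jacobiPoly_apply_zero (hpos : ∀ n, 1 ≤ n → 0 < ω n) {m n : ℕ} (h : n + 1 ≤ m) :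
    Polynomial.aeval (jacobiMatrix ω m) (jacobiPoly ω (n + 1)) 0 0 = 0 := by
  have h1 := congrFun (aeval_jacobiPoly_mulVec hpos m (n + 1) h) 0
  rw [jacobiVec_succ_apply_zero, jacobiVec_zero, Matrix.mulVec_single_one] at h1
  exact h1

lemma jacobiPoly_monic (ω : ℕ → ℝ) :
    ∀ n, (jacobiPoly ω n).Monic ∧ (jacobiPoly ω n).natDegree = n
  | 0 => by simp [jacobiPoly]
  | 1 => by simp [jacobiPoly, Polynomial.monic_X]
  | n + 2 => by
    obtain ⟨h0, d0⟩ := jacobiPoly_monic ω n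
    obtain ⟨h1, d1⟩ := jacobiPoly_monic ω (n + 1)
    have hX : (Polynomial.X * jacobiPoly ω (n + 1)).Monic := Polynomial.monic_X.mul h1
    have hd : (Polynomial.X * jacobiPoly ω (n + 1)).natDegree = n + 2 := by
      rw [Polynomial.monic_X.natDegree_mul h1, d1, Polynomial.natDegree_X]; ring
    have hlt : (Polynomial.C (ω (n + 1)) * jacobiPoly ω n).natDegree <
        (Polynomial.X * jacobiPoly ω (n + 1)).natDegree := by
      refine (Polynomial.natDegree_C_mul_le _ _).trans_lt ?_
      omega
    rw [jacobiPoly]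
    exact ⟨hX.sub_of_left (Polynomial.degree_lt_degree hlt),
      (Polynomial.natDegree_sub_eq_left_of_natDegree_lt hlt).trans hd⟩

lemma jacobiPoly_eval_neg (ω : ℕ → ℝ) (x : ℝ) :
    ∀ n, (jacobiPoly ω n).eval (-x) = (-1) ^ n * (jacobiPoly ω n).eval x
  | 0 => by simp [jacobiPoly]
  | 1 => by simp [jacobiPoly]
  | n + 2 => by
    simp only [jacobiPoly, Polynomial.eval_sub, Polynomial.eval_mul, Polynomial.eval_X,
      Polynomial.eval_C, jacobiPoly_eval_neg ω x (n + 1), jacobiPoly_eval_neg ω x n]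
    ring

/-- Every polynomial is a linear combination of the `P_n`. -/
lemma induction_jacobiPoly (ω : ℕ → ℝ) {Q : Polynomial ℝ → Prop}
    (hP : ∀ n, Q (jacobiPoly ω n)) (hadd : ∀ p q, Q p → Q q → Q (p + q))
    (hmul : ∀ (c : ℝ) p, Q p → Q (Polynomial.C c * p)) (p : Polynomial ℝ) : Q p := by
  -- Letting `k` vary lets one factor `X` be absorbed by the recurrence; `k = 0` gives the
  -- monomials.
  have key : ∀ n k, Q (Polynomial.X ^ n * jacobiPoly ω k) := by
    intro n
    induction n with
    | zero => intro k; simpa using hP k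
    | succ n ih =>
      rintro (_ | k)
      · simpa [jacobiPoly, pow_succ] using ih 1
      · have e : Polynomial.X ^ (n + 1) * jacobiPoly ω (k + 1) =
            Polynomial.X ^ n * jacobiPoly ω (k + 2) +
              Polynomial.C (ω (k + 1)) * (Polynomial.X ^ n * jacobiPoly ω k) := by
          rw [jacobiPoly]; ring
        rw [e]
        exact hadd _ _ (ih _) (hmul _ _ (ih _))
  induction p using Polynomial.induction_on' with
  | add p q hp hq => exact hadd p q hp hq
  | monomial n a =>
    have := hmul a _ (key n 0)
    rwa [jacobiPoly, mul_one, Polynomial.C_mul_X_pow_eq_monomial] at this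

end Jacobi

/-! ### Spectral measures of Hermitian matrices -/

section SpectralMeasure

variable {n : Type*} [Fintype n] [DecidableEq n] {A : Matrix n n ℂ}

/-- The spectral measure of a Hermitian matrix at the basis vector `e_i`. -/
def Matrix.IsHermitian.spectralMeasure (hA : A.IsHermitian) (i : n) : Measure ℝ :=
  ∑ j, ENNReal.ofReal (‖(hA.eigenvectorUnitary : Matrix n n ℂ) i j‖ ^ 2) •
    Measure.dirac (hA.eigenvalues j)

namespace Matrix.IsHermitian

lemma integrable_spectralMeasure (hA : A.IsHermitian) (i : n) (f : ℝ → ℝ) :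
    Integrable f (hA.spectralMeasure i) := by
  rw [spectralMeasure, integrable_finsetSum_measure]
  exact fun j _ => (integrable_dirac (by simp)).smul_measure ENNReal.ofReal_ne_top

lemma integral_spectralMeasure (hA : A.IsHermitian) (i : n) (f : ℝ → ℝ) :
    ∫ x, f x ∂(hA.spectralMeasure i) =
      ∑ j, ‖(hA.eigenvectorUnitary : Matrix n n ℂ) i j‖ ^ 2 * f (hA.eigenvalues j) := by
  rw [spectralMeasure, integral_finsetSum_measure
    (fun j _ => (integrable_dirac (by simp)).smul_measure ENNReal.ofReal_ne_top)]
  refine Finset.sum_congr rfl fun j _ => ?_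
  rw [integral_smul_measure, integral_dirac, ENNReal.toReal_ofReal (by positivity), smul_eq_mul]

lemma unitary_conj_diagonal_apply (U : Matrix n n ℂ) (d : n → ℂ) (i : n) :
    (U * Matrix.diagonal d * star U) i i = ∑ j, ((‖U i j‖ ^ 2 : ℝ) : ℂ) * d j := by
  rw [Matrix.mul_apply]
  refine Finset.sum_congr rfl fun j _ => ?_
  rw [Matrix.mul_diagonal, Matrix.star_apply, Complex.star_def, mul_right_comm, Complex.mul_conj,
    Complex.normSq_eq_norm_sq]

lemma eq_unitary_conj_diagonal (hA : A.IsHermitian) :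
    A = (hA.eigenvectorUnitary : Matrix n n ℂ) *
      Matrix.diagonal (fun j => ((hA.eigenvalues j : ℝ) : ℂ)) *
      star (hA.eigenvectorUnitary : Matrix n n ℂ) := by
  conv_lhs => rw [hA.spectral_theorem, Unitary.conjStarAlgAut_apply]
  rfl

lemma aeval_eq_unitary_conj_diagonal (hA : A.IsHermitian) (p : Polynomial ℝ) :
    Polynomial.aeval A p = (hA.eigenvectorUnitary : Matrix n n ℂ) *
      Matrix.diagonal (fun j => ((p.eval (hA.eigenvalues j) : ℝ) : ℂ)) *
      star (hA.eigenvectorUnitary : Matrix n n ℂ) := by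
  set U := (hA.eigenvectorUnitary : Matrix n n ℂ) with hU
  have h1 : U * star U = 1 := Unitary.coe_mul_star_self hA.eigenvectorUnitary
  have h2 : star U * U = 1 := Unitary.coe_star_mul_self hA.eigenvectorUnitary
  induction p using Polynomial.induction_on with
  | C a =>
    have : Matrix.diagonal (fun _ : n => (a : ℂ)) = (a : ℂ) • (1 : Matrix n n ℂ) :=
      (Matrix.smul_one_eq_diagonal _).symm
    simp only [Polynomial.aeval_C, Polynomial.eval_C]
    rw [this, Matrix.mul_smul, Matrix.smul_mul, mul_one, h1, Algebra.algebraMap_eq_smul_one]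
    ext j k; simp
  | add p q hp hq =>
    rw [map_add, hp, hq, ← add_mul, ← mul_add, Matrix.diagonal_add]
    simp
  | monomial k a h =>
    rw [pow_succ, ← mul_assoc, map_mul, h, Polynomial.aeval_X]
    refine (congrArg (_ * ·) hA.eq_unitary_conj_diagonal).trans ?_
    rw [← hU]
    calc _ = U * Matrix.diagonal
            (fun j => ((Polynomial.eval (hA.eigenvalues j)
              (Polynomial.C a * Polynomial.X ^ k) : ℝ) : ℂ)) * (star U * U) *
            Matrix.diagonal (fun j => ((hA.eigenvalues j : ℝ) : ℂ)) * star U := by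
          simp only [mul_assoc]
      _ = _ := by
          rw [h2, mul_one, mul_assoc U, Matrix.diagonal_mul_diagonal]
          simp [mul_assoc]

lemma integral_eval_spectralMeasure (hA : A.IsHermitian) (i : n) (p : Polynomial ℝ) :
    ((∫ x, p.eval x ∂(hA.spectralMeasure i) : ℝ) : ℂ) = Polynomial.aeval A p i i := by
  rw [integral_spectralMeasure, aeval_eq_unitary_conj_diagonal hA, unitary_conj_diagonal_apply]
  push_cast
  rfl

lemma isProbabilityMeasure_spectralMeasure (hA : A.IsHermitian) (i : n) :
    IsProbabilityMeasure (hA.spectralMeasure i) := by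
  have h := hA.integral_eval_spectralMeasure i 1
  have hfin : IsFiniteMeasure (hA.spectralMeasure i) := by
    have := (integrable_const_iff (μ := hA.spectralMeasure i) (c := (1 : ℝ))).1
      (hA.integrable_spectralMeasure i _)
    simpa using this
  simp only [Polynomial.eval_one, integral_const, smul_eq_mul, mul_one, map_one,
    Matrix.one_apply_eq] at h
  have h' : (hA.spectralMeasure i).real Set.univ = 1 := by exact_mod_cast h
  exact ⟨by simpa [measureReal_def, ENNReal.toReal_eq_one_iff] using h'⟩

/-- Diagonalize the resolvent and use `Im 1/(i - x) = -1/(1 + x²)` for real `x`. -/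
lemma integral_one_div_spectralMeasure (hA : A.IsHermitian) (i : n) :
    ∫ x, 1 / (1 + x ^ 2) ∂(hA.spectralMeasure i) =
      -((Matrix.scalar n Complex.I - A)⁻¹ i i).im := by
  set U := (hA.eigenvectorUnitary : Matrix n n ℂ) with hU
  have h1 : U * star U = 1 := Unitary.coe_mul_star_self hA.eigenvectorUnitary
  have h2 : star U * U = 1 := Unitary.coe_star_mul_self hA.eigenvectorUnitary
  have hne : ∀ x : ℝ, Complex.I - (x : ℂ) ≠ 0 := fun x h => by
    simpa using congrArg Complex.im h
  have hinv : (Matrix.scalar n Complex.I - A)⁻¹ = U *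
      Matrix.diagonal (fun j => (Complex.I - (hA.eigenvalues j : ℂ))⁻¹) * star U := by
    apply Matrix.inv_eq_right_inv
    have e : Matrix.scalar n Complex.I - A =
        U * Matrix.diagonal (fun j => Complex.I - (hA.eigenvalues j : ℂ)) * star U := by
      rw [← Matrix.diagonal_sub, mul_sub, sub_mul, hU, ← hA.eq_unitary_conj_diagonal,
        Matrix.scalar_apply, ← Matrix.smul_one_eq_diagonal, Matrix.mul_smul, Matrix.smul_mul,
        mul_one, ← hU, h1]
    rw [e]
    calc _ = U * Matrix.diagonal (fun j => Complex.I - (hA.eigenvalues j : ℂ)) * (star U * U) *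
          Matrix.diagonal (fun j => (Complex.I - (hA.eigenvalues j : ℂ))⁻¹) * star U := by
          simp only [mul_assoc]
      _ = _ := by
          rw [h2, mul_one, mul_assoc U, Matrix.diagonal_mul_diagonal]
          simp [mul_inv_cancel₀ (hne _), h1]
  rw [integral_spectralMeasure, hinv, unitary_conj_diagonal_apply, Complex.im_sum,
    ← Finset.sum_neg_distrib]
  refine Finset.sum_congr rfl fun j _ => ?_
  rw [Complex.im_ofReal_mul, Complex.inv_im, ← mul_neg]
  congr 1
  simp [Complex.normSq_apply]
  ring

end Matrix.IsHermitian

end SpectralMeasure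

/-! ### Weak limits and integrals of unbounded functions -/

section WeakLimits

/-- The truncation `f / (1 + δ² f²)` as a bounded continuous function. -/
def truncation {f : ℝ → ℝ} (hf : Continuous f) {δ : ℝ} (hδ : 0 < δ) :
    BoundedContinuousFunction ℝ ℝ :=
  BoundedContinuousFunction.ofNormedAddCommGroup (fun x => f x / (1 + δ ^ 2 * f x ^ 2))
    (hf.div (by fun_prop) fun x => by positivity) (1 / δ) fun x => by
      rw [Real.norm_eq_abs, abs_div, abs_of_pos (by positivity : 0 < 1 + δ ^ 2 * f x ^ 2),
        div_le_div_iff₀ (by positivity) hδ]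
      nlinarith [sq_nonneg (1 - δ * |f x|), sq_abs (f x), abs_nonneg (f x), hδ,
        mul_nonneg hδ.le (abs_nonneg (f x))]

/-- The error is `δ²|f|³ / (1 + δ²f²)`, and `δ|f| ≤ 1 + δ²f²`. -/
lemma abs_sub_truncation_le {f : ℝ → ℝ} (hf : Continuous f) {δ : ℝ} (hδ : 0 < δ) (x : ℝ) :
    |f x - truncation hf hδ x| ≤ δ * f x ^ 2 := by
  have hd : 0 < 1 + δ ^ 2 * f x ^ 2 := by positivity
  have e : f x - truncation hf hδ x = δ ^ 2 * f x ^ 3 / (1 + δ ^ 2 * f x ^ 2) := by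
    change f x - f x / (1 + δ ^ 2 * f x ^ 2) = _
    field_simp
    ring
  rw [e, abs_div, abs_of_pos hd, div_le_iff₀ hd, abs_mul, abs_of_pos (by positivity : 0 < δ ^ 2),
    abs_pow, ← sq_abs (f x)]
  have h0 := abs_nonneg (f x)
  have : 0 ≤ δ * |f x| ^ 2 * (1 + δ ^ 2 * |f x| ^ 2 - δ * |f x|) := by
    have : 0 ≤ 1 + δ ^ 2 * |f x| ^ 2 - δ * |f x| := by
      nlinarith [sq_nonneg (1 - δ * |f x|), mul_nonneg hδ.le h0]
    positivity
  nlinarith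

variable {ι : Type*} {F : Filter ι} [F.NeBot] {μs : ι → ProbabilityMeasure ℝ}
  {ν : ProbabilityMeasure ℝ}

/-- The cut-offs `min (f²) N` are bounded and continuous, so the bound passes to the weak limit;
Fatou's lemma then removes the cut-off. -/
lemma integrable_sq_of_tendsto (h : Tendsto μs F (𝓝 ν)) {f : ℝ → ℝ} (hf : Continuous f) {C : ℝ}
    (hint : ∀ᶠ i in F, Integrable (fun x => f x ^ 2) (μs i : Measure ℝ))
    (hC : ∀ᶠ i in F, ∫ x, f x ^ 2 ∂(μs i : Measure ℝ) ≤ C) :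
    Integrable (fun x => f x ^ 2) (ν : Measure ℝ) ∧ ∫ x, f x ^ 2 ∂(ν : Measure ℝ) ≤ C := by
  have hC0 : 0 ≤ C := by
    obtain ⟨i, hi⟩ := hC.exists
    exact (integral_nonneg fun x => sq_nonneg _).trans hi
  let g : ℕ → BoundedContinuousFunction ℝ ℝ := fun N =>
    BoundedContinuousFunction.ofNormedAddCommGroup (fun x => min (f x ^ 2) N)
      ((hf.pow 2).min continuous_const) N fun x => by
        rw [Real.norm_eq_abs, abs_of_nonneg (by positivity)]; exact min_le_right _ _
  have hg : ∀ N x, g N x = min (f x ^ 2) N := fun N x => rfl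
  have hgN : ∀ N, ∫ x, g N x ∂(ν : Measure ℝ) ≤ C := by
    intro N
    refine le_of_tendsto (ProbabilityMeasure.tendsto_iff_forall_integral_tendsto.1 h (g N)) ?_
    filter_upwards [hint, hC] with i hi hCi
    refine (integral_mono ((g N).integrable _) hi fun x => ?_).trans hCi
    exact min_le_left _ _
  have hl : ∫⁻ x, ENNReal.ofReal (f x ^ 2) ∂(ν : Measure ℝ) ≤ ENNReal.ofReal C := by
    have hlim : ∀ x, liminf (fun N => ENNReal.ofReal (g N x)) atTop = ENNReal.ofReal (f x ^ 2) := by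
      intro x
      refine Tendsto.liminf_eq (tendsto_const_nhds.congr' ?_)
      obtain ⟨N, hN⟩ := exists_nat_ge (f x ^ 2)
      filter_upwards [eventually_ge_atTop N] with M hM
      have hM' : (N : ℝ) ≤ M := by exact_mod_cast hM
      rw [hg, min_eq_left (hN.trans hM')]
    calc ∫⁻ x, ENNReal.ofReal (f x ^ 2) ∂(ν : Measure ℝ)
        = ∫⁻ x, liminf (fun N => ENNReal.ofReal (g N x)) atTop ∂(ν : Measure ℝ) := by
          simp_rw [hlim]
      _ ≤ liminf (fun N => ∫⁻ x, ENNReal.ofReal (g N x) ∂(ν : Measure ℝ)) atTop :=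
          lintegral_liminf_le fun N => (g N).continuous.measurable.ennreal_ofReal
      _ ≤ ENNReal.ofReal C := by
          refine liminf_le_of_le (by isBoundedDefault) fun b hb => ?_
          obtain ⟨N, hN⟩ := hb.exists
          refine hN.trans ?_
          rw [← ofReal_integral_eq_lintegral_ofReal ((g N).integrable _)
            (Eventually.of_forall fun x => by rw [hg]; positivity)]
          exact ENNReal.ofReal_le_ofReal (hgN N)
  have hnn : 0 ≤ᵐ[(ν : Measure ℝ)] fun x => f x ^ 2 := Eventually.of_forall fun x => sq_nonneg _
  have hI : Integrable (fun x => f x ^ 2) (ν : Measure ℝ) :=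
    (lintegral_ofReal_ne_top_iff_integrable (hf.pow 2).aestronglyMeasurable hnn).1
      (hl.trans_lt ENNReal.ofReal_lt_top).ne
  refine ⟨hI, ?_⟩
  rw [← ofReal_integral_eq_lintegral_ofReal hI hnn] at hl
  exact (ENNReal.ofReal_le_ofReal_iff hC0).1 hl

lemma abs_integral_sub_truncation_le {μ : Measure ℝ} [IsProbabilityMeasure μ] {f : ℝ → ℝ}
    (hf : Continuous f) {C : ℝ} (hint : Integrable (fun x => f x ^ 2) μ)
    (hC : ∫ x, f x ^ 2 ∂μ ≤ C) {δ : ℝ} (hδ : 0 < δ) :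
    |∫ x, f x ∂μ - ∫ x, truncation hf hδ x ∂μ| ≤ δ * C := by
  have hfi : Integrable f μ :=
    ((memLp_two_iff_integrable_sq hf.aestronglyMeasurable).2 hint).integrable (by norm_num)
  rw [← integral_sub hfi ((truncation hf hδ).integrable _)]
  calc |∫ x, (f x - truncation hf hδ x) ∂μ| ≤ ∫ x, |f x - truncation hf hδ x| ∂μ :=
        abs_integral_le_integral_abs
    _ ≤ ∫ x, δ * f x ^ 2 ∂μ :=
        integral_mono (hfi.sub ((truncation hf hδ).integrable _)).abs (hint.const_mul δ)
          (abs_sub_truncation_le hf hδ)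
    _ = δ * ∫ x, f x ^ 2 ∂μ := integral_const_mul _ _
    _ ≤ δ * C := by gcongr

/-- Weak convergence and bounded second moments of `f` imply convergence of `∫ f`. -/
lemma tendsto_integral_of_sq_integral_le (h : Tendsto μs F (𝓝 ν)) {f : ℝ → ℝ} (hf : Continuous f)
    {C : ℝ} (hint : ∀ᶠ i in F, Integrable (fun x => f x ^ 2) (μs i : Measure ℝ))
    (hC : ∀ᶠ i in F, ∫ x, f x ^ 2 ∂(μs i : Measure ℝ) ≤ C) :
    Tendsto (fun i => ∫ x, f x ∂(μs i : Measure ℝ)) F (𝓝 (∫ x, f x ∂(ν : Measure ℝ))) := by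
  obtain ⟨hνi, hνC⟩ := integrable_sq_of_tendsto h hf hint hC
  have hC0 : 0 ≤ C := (integral_nonneg fun x => sq_nonneg _).trans hνC
  rw [Metric.tendsto_nhds]
  intro ε hε
  -- Each of the two truncation errors is at most `δ C < ε / 3`; `C + 1` allows for `C = 0`.
  have hδ : 0 < ε / (3 * (C + 1)) := by positivity
  set δ := ε / (3 * (C + 1)) with hδe
  have hδC : δ * C < ε / 3 := by
    rw [hδe, div_mul_eq_mul_div, div_lt_div_iff₀ (by positivity) (by norm_num)]
    nlinarith
  have ht := ProbabilityMeasure.tendsto_iff_forall_integral_tendsto.1 h (truncation hf hδ)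
  filter_upwards [hint, hC, Metric.tendsto_nhds.1 ht (ε / 3) (by positivity)] with i hi hCi hti
  have a := abs_integral_sub_truncation_le hf hi hCi hδ
  have b := abs_integral_sub_truncation_le hf hνi hνC hδ
  rw [Real.dist_eq] at hti ⊢
  rw [abs_lt] at hti ⊢
  rw [abs_le] at a b
  constructor <;> linarith [hti.1, hti.2, a.1, a.2, b.1, b.2]

/-- Bounded second moments give tightness. -/
lemma isTightMeasureSet_of_sq_integral_le {S : Set (Measure ℝ)} {C : ℝ}
    (hint : ∀ μ ∈ S, Integrable (fun x : ℝ => x ^ 2) μ)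
    (hC : ∀ μ ∈ S, ∫ x, x ^ 2 ∂μ ≤ C) : IsTightMeasureSet S := by
  rw [isTightMeasureSet_iff_exists_isCompact_measure_compl_le]
  intro ε hε
  obtain ⟨r, hr0, hr⟩ : ∃ r : ℝ, 0 < r ∧ ENNReal.ofReal (C / r ^ 2) ≤ ε := by
    have ht : Tendsto (fun r : ℝ => ENNReal.ofReal (C / r ^ 2)) atTop (𝓝 0) := by
      have : Tendsto (fun r : ℝ => C / r ^ 2) atTop (𝓝 0) :=
        tendsto_const_nhds.div_atTop (tendsto_pow_atTop two_ne_zero)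
      simpa using ENNReal.tendsto_ofReal this
    obtain ⟨r, h1, h2⟩ := ((eventually_gt_atTop 0).and (ht.eventually_lt_const hε)).exists
    exact ⟨r, h1, h2.le⟩
  refine ⟨Metric.closedBall 0 r, isCompact_closedBall _ _, fun μ hμ => le_trans ?_ hr⟩
  -- Markov's inequality for `x²` at level `r²`.
  have hm := meas_ge_le_lintegral_div (μ := μ) (f := fun x : ℝ => ENNReal.ofReal (x ^ 2))
    (by fun_prop) (ε := ENNReal.ofReal (r ^ 2)) (by simpa using hr0.ne')
    ENNReal.ofReal_ne_top
  refine (measure_mono fun x hx => ?_).trans (hm.trans ?_)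
  · simp only [Set.mem_compl_iff, Metric.mem_closedBall, dist_zero_right, Real.norm_eq_abs,
      not_le] at hx
    apply ENNReal.ofReal_le_ofReal
    rw [← sq_abs x]
    gcongr
  · rw [← ofReal_integral_eq_lintegral_ofReal (hint μ hμ)
      (Eventually.of_forall fun x => sq_nonneg x), ENNReal.ofReal_div_of_pos (by positivity)]
    gcongr
    exact hC μ hμ

end WeakLimits

/-! ### Limit points of the truncated spectral measures -/

section JacobiMeasures

variable {ω : ℕ → ℝ}

/-- The spectral measure of the truncated Jacobi matrix at the first basis vector. -/
def truncatedMeasure (ω : ℕ → ℝ) (m : ℕ) : ProbabilityMeasure ℝ :=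
  ⟨(isHermitian_jacobiMatrix ω m).spectralMeasure 0,
    (isHermitian_jacobiMatrix ω m).isProbabilityMeasure_spectralMeasure 0⟩

lemma integrable_truncatedMeasure (ω : ℕ → ℝ) (m : ℕ) (f : ℝ → ℝ) :
    Integrable f (truncatedMeasure ω m : Measure ℝ) :=
  (isHermitian_jacobiMatrix ω m).integrable_spectralMeasure 0 f

lemma integral_jacobiPoly_truncatedMeasure (hpos : ∀ n, 1 ≤ n → 0 < ω n) {m n : ℕ}
    (h : n + 1 ≤ m) : ∫ x, (jacobiPoly ω (n + 1)).eval x ∂(truncatedMeasure ω m : Measure ℝ) = 0 := by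
  have := (isHermitian_jacobiMatrix ω m).integral_eval_spectralMeasure 0 (jacobiPoly ω (n + 1))
  rw [aeval_jacobiPoly_apply_zero hpos h] at this
  exact_mod_cast this

lemma integral_one_div_truncatedMeasure (hpos : ∀ n, 1 ≤ n → 0 < ω n) (m : ℕ) :
    ∫ x, 1 / (1 + x ^ 2) ∂(truncatedMeasure ω m : Measure ℝ) = seqA ω m / seqB ω m := by
  have h := (isHermitian_jacobiMatrix ω m).integral_one_div_spectralMeasure 0
  change ∫ x, 1 / (1 + x ^ 2) ∂(truncatedMeasure ω m : Measure ℝ) = -(stieltjesAtI ω m).im at h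
  rw [h, stieltjesAtI_eq hpos, Complex.im_mul_ofReal]
  simp

/-- The `P_n` span all polynomials, and `P_n` with `n ≥ 1` integrates to zero as soon as `m ≥ n`. -/
lemma integral_eval_truncatedMeasure_eventually_const (hpos : ∀ n, 1 ≤ n → 0 < ω n)
    (p : Polynomial ℝ) :
    ∃ c, ∀ᶠ m in atTop, ∫ x, p.eval x ∂(truncatedMeasure ω m : Measure ℝ) = c := by
  refine induction_jacobiPoly ω (Q := fun p => ∃ c, ∀ᶠ m in atTop,
    ∫ x, p.eval x ∂(truncatedMeasure ω m : Measure ℝ) = c) ?_ ?_ ?_ p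
  · rintro (_ | n)
    · exact ⟨1, Eventually.of_forall fun m => by simp [jacobiPoly]⟩
    · refine ⟨0, ?_⟩
      filter_upwards [eventually_ge_atTop (n + 1)] with m hm
      exact integral_jacobiPoly_truncatedMeasure hpos hm
  · rintro p q ⟨c, hc⟩ ⟨d, hd⟩
    refine ⟨c + d, ?_⟩
    filter_upwards [hc, hd] with m h1 h2
    simp only [Polynomial.eval_add]
    rw [integral_add (integrable_truncatedMeasure _ _ _) (integrable_truncatedMeasure _ _ _), h1, h2]
  · rintro a p ⟨c, hc⟩
    refine ⟨a * c, ?_⟩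
    filter_upwards [hc] with m h1
    simp only [Polynomial.eval_mul, Polynomial.eval_C]
    rw [integral_const_mul, h1]

/-- Along any sequence of truncations there is a limit measure that annihilates the `P_n`. -/
lemma exists_limit_measure (hpos : ∀ n, 1 ≤ n → 0 < ω n) {φ : ℕ → ℕ}
    (hφ : Tendsto φ atTop atTop) {s : ℝ}
    (hs : Tendsto (fun m => seqA ω (φ m) / seqB ω (φ m)) atTop (𝓝 s)) :
    ∃ ν : Measure ℝ, IsProbabilityMeasure ν ∧
      (∀ p : Polynomial ℝ, Integrable (fun x => p.eval x) ν) ∧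
      (∀ n, ∫ x, (jacobiPoly ω (n + 1)).eval x ∂ν = 0) ∧ ∫ x, 1 / (1 + x ^ 2) ∂ν = s := by
  obtain ⟨c, hc⟩ := integral_eval_truncatedMeasure_eventually_const hpos (Polynomial.X ^ 2)
  obtain ⟨N, hN⟩ := eventually_atTop.1 hc
  have htight : IsTightMeasureSet
      {((μ : ProbabilityMeasure ℝ) : Measure ℝ) | μ ∈ truncatedMeasure ω '' Set.Ici N} := by
    refine isTightMeasureSet_of_sq_integral_le (C := c) ?_ ?_
    · rintro _ ⟨_, ⟨m, _, rfl⟩, rfl⟩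
      exact integrable_truncatedMeasure _ _ _
    · rintro _ ⟨_, ⟨m, hm, rfl⟩, rfl⟩
      simpa using (hN m hm).le
  have hcomp := isCompact_closure_of_isTightMeasureSet htight
  -- A free ultrafilter converges in the compact closure given by Prokhorov's theorem, so no
  -- subsequence has to be extracted.
  obtain ⟨ν, -, hν⟩ := hcomp.ultrafilter_le_nhds
    ((hyperfilter ℕ).map fun m => truncatedMeasure ω (φ m)) (by
      rw [le_principal_iff, Ultrafilter.mem_coe, Ultrafilter.mem_map]
      have h1 : ∀ᶠ m in (atTop : Filter ℕ), truncatedMeasure ω (φ m) ∈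
          closure (truncatedMeasure ω '' Set.Ici N) := by
        filter_upwards [hφ.eventually_ge_atTop N] with m hm
        exact subset_closure ⟨_, hm, rfl⟩
      exact Nat.hyperfilter_le_atTop h1)
  have hF : ((hyperfilter ℕ : Ultrafilter ℕ) : Filter ℕ) ≤ atTop := Nat.hyperfilter_le_atTop
  have hlim : Tendsto (fun m => truncatedMeasure ω (φ m)) (hyperfilter ℕ : Filter ℕ) (𝓝 ν) := hν
  have hpoly : ∀ p : Polynomial ℝ, ∃ C, ∀ᶠ m in (hyperfilter ℕ : Filter ℕ),
      ∫ x, p.eval x ^ 2 ∂(truncatedMeasure ω (φ m) : Measure ℝ) ≤ C := by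
    intro p
    -- The square of a polynomial is a polynomial, so its integrals are eventually constant, hence
    -- bounded.
    obtain ⟨C, hC⟩ := integral_eval_truncatedMeasure_eventually_const hpos (p ^ 2)
    refine ⟨C, ?_⟩
    filter_upwards [hF (hφ.eventually hC)] with m hm
    simpa using hm.le
  have hint : ∀ p : Polynomial ℝ, ∀ᶠ m in (hyperfilter ℕ : Filter ℕ),
      Integrable (fun x => p.eval x ^ 2) (truncatedMeasure ω (φ m) : Measure ℝ) :=
    fun p => Eventually.of_forall fun m => integrable_truncatedMeasure _ _ _
  refine ⟨ν, inferInstance, fun p => ?_, fun n => ?_, ?_⟩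
  · obtain ⟨C, hC⟩ := hpoly p
    exact ((memLp_two_iff_integrable_sq p.continuous.aestronglyMeasurable).2
      (integrable_sq_of_tendsto hlim p.continuous (hint p) hC).1).integrable (by norm_num)
  · obtain ⟨C, hC⟩ := hpoly (jacobiPoly ω (n + 1))
    refine tendsto_nhds_unique (tendsto_integral_of_sq_integral_le hlim
      (jacobiPoly ω (n + 1)).continuous (hint _) hC) (tendsto_const_nhds.congr' ?_)
    filter_upwards [hF (hφ.eventually_ge_atTop (n + 1))] with m hm
    exact (integral_jacobiPoly_truncatedMeasure hpos hm).symm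
  · have hcont : Continuous fun x : ℝ => 1 / (1 + x ^ 2) :=
      continuous_const.div (by fun_prop) fun x => by positivity
    have h1 : ∀ x : ℝ, (1 / (1 + x ^ 2)) ^ 2 ≤ 1 := fun x =>
      pow_le_one₀ (by positivity) (by rw [div_le_one (by positivity)]; nlinarith [sq_nonneg x])
    refine tendsto_nhds_unique (tendsto_integral_of_sq_integral_le (C := 1) hlim hcont
      (Eventually.of_forall fun m => integrable_truncatedMeasure _ _ _)
      (Eventually.of_forall fun m => ?_)) ?_
    · refine (integral_mono (integrable_truncatedMeasure _ _ _)
        (integrable_truncatedMeasure _ _ (fun _ => 1)) h1).trans ?_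
      simp
    · simp_rw [integral_one_div_truncatedMeasure hpos]
      exact hs.mono_left hF

/-- Moving a factor `x` from one polynomial to the other lowers the smaller index and keeps it
strictly below the larger one, until only `∫ P_n` with `n ≥ 1` is left. -/
lemma integral_jacobiPoly_mul_eq_zero {μ : Measure ℝ}
    (hint : ∀ p : Polynomial ℝ, Integrable (fun x => p.eval x) μ)
    (hzero : ∀ n, ∫ x, (jacobiPoly ω (n + 1)).eval x ∂μ = 0) :
    ∀ m n, m < n → ∫ x, (jacobiPoly ω m).eval x * (jacobiPoly ω n).eval x ∂μ = 0
  | 0, n + 1, _ => by simpa [jacobiPoly] using hzero n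
  | 1, n + 2, _ => by
    have e : ∀ x, (jacobiPoly ω 1).eval x * (jacobiPoly ω (n + 2)).eval x =
        (jacobiPoly ω (n + 3)).eval x + ω (n + 2) * (jacobiPoly ω (n + 1)).eval x := by
      intro x
      rw [show jacobiPoly ω (n + 3) = Polynomial.X * jacobiPoly ω (n + 2) -
        Polynomial.C (ω (n + 2)) * jacobiPoly ω (n + 1) from rfl]
      simp [jacobiPoly]
    simp_rw [e]
    rw [integral_add (hint _) ((hint _).const_mul _), integral_const_mul, hzero, hzero]
    simp
  | m + 2, n + 1, h => by
    obtain ⟨k, rfl⟩ : ∃ k, n = k + 1 := ⟨n - 1, by omega⟩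
    have e : ∀ x, (jacobiPoly ω (m + 2)).eval x * (jacobiPoly ω (k + 2)).eval x =
        (jacobiPoly ω (m + 1)).eval x * (jacobiPoly ω (k + 3)).eval x +
          ω (k + 2) * ((jacobiPoly ω (m + 1)).eval x * (jacobiPoly ω (k + 1)).eval x) -
          ω (m + 1) * ((jacobiPoly ω m).eval x * (jacobiPoly ω (k + 2)).eval x) := by
      intro x
      rw [show jacobiPoly ω (k + 3) = Polynomial.X * jacobiPoly ω (k + 2) -
        Polynomial.C (ω (k + 2)) * jacobiPoly ω (k + 1) from rfl,
        show jacobiPoly ω (m + 2) = Polynomial.X * jacobiPoly ω (m + 1) -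
        Polynomial.C (ω (m + 1)) * jacobiPoly ω m from rfl]
      simp only [Polynomial.eval_sub, Polynomial.eval_mul, Polynomial.eval_X, Polynomial.eval_C]
      ring
    have hi : ∀ i j, Integrable
        (fun x => (jacobiPoly ω i).eval x * (jacobiPoly ω j).eval x) μ := fun i j => by
      simpa using hint (jacobiPoly ω i * jacobiPoly ω j)
    simp_rw [e]
    have hsum : Integrable (fun x => (jacobiPoly ω (m + 1)).eval x * (jacobiPoly ω (k + 3)).eval x +
        ω (k + 2) * ((jacobiPoly ω (m + 1)).eval x * (jacobiPoly ω (k + 1)).eval x)) μ :=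
      (hi _ _).add ((hi _ _).const_mul _)
    rw [integral_sub hsum ((hi _ _).const_mul _), integral_add (hi _ _) ((hi _ _).const_mul _),
      integral_const_mul, integral_const_mul,
      integral_jacobiPoly_mul_eq_zero hint hzero (m + 1) (k + 3) (by omega),
      integral_jacobiPoly_mul_eq_zero hint hzero (m + 1) (k + 1) (by omega),
      integral_jacobiPoly_mul_eq_zero hint hzero m (k + 2) (by omega)]
    simp

lemma isSymmetricWithJacobi_of_integral_jacobiPoly {μ : Measure ℝ} (hprob : IsProbabilityMeasure μ)
    (hsymm : μ.map (fun x : ℝ => -x) = μ)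
    (hint : ∀ p : Polynomial ℝ, Integrable (fun x => p.eval x) μ)
    (hzero : ∀ n, ∫ x, (jacobiPoly ω (n + 1)).eval x ∂μ = 0) : IsSymmetricWithJacobi ω μ where
  prob := hprob
  symm := hsymm
  moments n := by simpa using hint (Polynomial.X ^ n)
  jacobi := by
    refine ⟨jacobiPoly ω, ⟨jacobiPoly_monic ω, fun m n hmn => ?_⟩, by simp [jacobiPoly],
      fun n => by simp [jacobiPoly]⟩
    rcases lt_or_gt_of_ne hmn with h | h
    · exact integral_jacobiPoly_mul_eq_zero hint hzero m n h
    · simp_rw [mul_comm ((jacobiPoly ω m).eval _)]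
      exact integral_jacobiPoly_mul_eq_zero hint hzero n m h

/-! ### Symmetrization -/

/-- The symmetrization `(ν + ν(-·)) / 2` of a measure on the line. -/
def symmetrization (ν : Measure ℝ) : Measure ℝ :=
  (2⁻¹ : ENNReal) • (ν + ν.map (fun x : ℝ => -x))

lemma map_neg_symmetrization (ν : Measure ℝ) :
    (symmetrization ν).map (fun x : ℝ => -x) = symmetrization ν := by
  rw [symmetrization, Measure.map_smul, Measure.map_add _ _ measurable_neg,
    Measure.map_map measurable_neg measurable_neg]
  simp [add_comm]

lemma isProbabilityMeasure_symmetrization (ν : Measure ℝ) [IsProbabilityMeasure ν] :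
    IsProbabilityMeasure (symmetrization ν) := by
  constructor
  have : (ν.map (fun x : ℝ => -x)) Set.univ = 1 := by
    rw [Measure.map_apply measurable_neg MeasurableSet.univ]; simp
  rw [symmetrization, Measure.smul_apply, Measure.add_apply, this, measure_univ, smul_eq_mul,
    one_add_one_eq_two, ENNReal.inv_mul_cancel two_ne_zero ENNReal.ofNat_ne_top]

lemma integrable_symmetrization {ν : Measure ℝ} {f : ℝ → ℝ} (hf : Integrable f ν)
    (hf' : Integrable (fun x => f (-x)) ν) : Integrable f (symmetrization ν) := by
  refine (Integrable.add_measure hf ?_).smul_measure (by simp)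
  exact (integrable_map_equiv (MeasurableEquiv.neg ℝ) f).2 hf'

lemma integral_symmetrization {ν : Measure ℝ} {f : ℝ → ℝ} (hf : Integrable f ν)
    (hf' : Integrable (fun x => f (-x)) ν) :
    ∫ x, f x ∂(symmetrization ν) = (∫ x, f x ∂ν + ∫ x, f (-x) ∂ν) / 2 := by
  have h : Integrable f (ν.map (fun x : ℝ => -x)) :=
    (integrable_map_equiv (MeasurableEquiv.neg ℝ) f).2 hf'
  have h2 : ∫ x, f x ∂(ν.map (fun x : ℝ => -x)) = ∫ x, f (-x) ∂ν :=
    integral_map_equiv (MeasurableEquiv.neg ℝ) f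
  rw [symmetrization, integral_smul_measure, integral_add_measure hf h, h2]
  simp
  ring

/-- Since `P_n(-x) = (-1)^n P_n(x)`, symmetrizing the limit measure keeps `∫ P_n = 0` for `n ≥ 1`,
and it keeps the integral of the even function `1/(1+x²)`. -/
lemma exists_isSymmetricWithJacobi (hpos : ∀ n, 1 ≤ n → 0 < ω n) {φ : ℕ → ℕ}
    (hφ : Tendsto φ atTop atTop) {s : ℝ}
    (hs : Tendsto (fun m => seqA ω (φ m) / seqB ω (φ m)) atTop (𝓝 s)) :
    ∃ μ : Measure ℝ, IsSymmetricWithJacobi ω μ ∧ ∫ x, 1 / (1 + x ^ 2) ∂μ = s := by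
  obtain ⟨ν, hprob, hint, hzero, hν⟩ := exists_limit_measure hpos hφ hs
  have hint' : ∀ p : Polynomial ℝ, Integrable (fun x => p.eval (-x)) ν := fun p => by
    simpa using hint (p.comp (-Polynomial.X))
  refine ⟨symmetrization ν, isSymmetricWithJacobi_of_integral_jacobiPoly
    (isProbabilityMeasure_symmetrization ν) (map_neg_symmetrization ν)
    (fun p => integrable_symmetrization (hint p) (hint' p)) (fun n => ?_), ?_⟩
  · rw [integral_symmetrization (hint _) (hint' _)]
    simp_rw [jacobiPoly_eval_neg]
    rw [integral_const_mul, hzero]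
    simp
  · have hb : Integrable (fun x : ℝ => 1 / (1 + x ^ 2)) ν := by
      refine (integrable_const (1 : ℝ)).mono'
        (continuous_const.div (by fun_prop) fun x => by positivity).aestronglyMeasurable
        (Eventually.of_forall fun x => ?_)
      rw [Real.norm_eq_abs, abs_of_pos (by positivity), div_le_one (by positivity)]
      nlinarith [sq_nonneg x]
    rw [integral_symmetrization hb (by simpa using hb)]
    simp only [neg_sq, hν]
    ring

end JacobiMeasures

lemma separatelyConverges_of_convergents {ω : ℕ → ℝ} (hpos : ∀ n, 1 ≤ n → 0 < ω n) {s t : ℝ}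
    (hs : Tendsto (fun m => seqA ω (2 * m) / seqB ω (2 * m)) atTop (𝓝 s))
    (ht : Tendsto (fun m => seqA ω (2 * m + 1) / seqB ω (2 * m + 1)) atTop (𝓝 t))
    (hst : s ≠ t) : SeparatelyConverges ω := by
  refine ⟨-Complex.I * (s : ℂ), -Complex.I * (t : ℂ), ?_, ?_, fun h => hst ?_⟩
  · simp_rw [stieltjesAtI_eq hpos]
    exact ((Complex.continuous_ofReal.tendsto s).comp hs).const_mul _
  · simp_rw [stieltjesAtI_eq hpos]
    exact ((Complex.continuous_ofReal.tendsto t).comp ht).const_mul _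
  · exact_mod_cast mul_left_cancel₀ (neg_ne_zero.2 Complex.I_ne_zero) h

end

theorem mainTheorem5 (ω : ℕ → ℝ) (hpos : ∀ n, 1 ≤ n → 0 < ω n)
    (α : ℝ) (hα0 : 0 < α) (hα1 : α < 1) (n₀ : ℕ)
    (hω : ∀ n, 1 ≤ n → n₀ ≤ n → ω n < α * ω (n + 1)) :
    (∃ K : ℝ, 0 < K ∧ ∀ n, 0 < seqC ω n ∧ seqC ω n ≤ K * Real.sqrt α ^ n) ∧
    PropertySC ω ∧
    ∃ μ ν : Measure ℝ, IsSymmetricWithJacobi ω μ ∧ IsSymmetricWithJacobi ω ν ∧ μ ≠ ν := by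
  obtain ⟨K, hK0, hK⟩ := seqC_le_geometric hpos hα0 hα1 hω
  obtain ⟨T, hT⟩ := seqB_div_stepProd_le hpos hα0 hα1 hω
  obtain ⟨L, hL0, hL⟩ := partialProd_tendsto hpos hT
  obtain ⟨s, t, hs, ht, hst⟩ := convergents_tendsto hpos hL0 hL
  have hsum : Summable (seqC ω) := by
    have hs1 : Real.sqrt α < 1 := by rw [Real.sqrt_lt' one_pos]; simpa using hα1
    exact Summable.of_nonneg_of_le (fun n => (seqC_pos hpos n).le) hK
      ((summable_geometric_of_lt_one (Real.sqrt_nonneg α) hs1).mul_left K)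
  refine ⟨⟨K, hK0, fun n => ⟨seqC_pos hpos n, hK n⟩⟩,
    ⟨separatelyConverges_of_convergents hpos hs ht hst, ⟨L, hL0, hL⟩,
      hasFiniteSum_of_summable hpos hsum⟩, ?_⟩
  have heven : Tendsto (fun m : ℕ => 2 * m) atTop atTop :=
    tendsto_atTop_mono (fun m => by simp only [id]; omega) tendsto_id
  have hodd : Tendsto (fun m : ℕ => 2 * m + 1) atTop atTop :=
    tendsto_atTop_mono (fun m => by simp only [id]; omega) tendsto_id
  obtain ⟨μ, hμ, hμs⟩ := exists_isSymmetricWithJacobi hpos heven hs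
  obtain ⟨ν, hν, hνt⟩ := exists_isSymmetricWithJacobi hpos hodd ht
  -- The measures are told apart by `∫ 1/(1+x²)`, which equals `s` for one and `t` for the other.
  exact ⟨μ, ν, hμ, hν, fun h => hst (by rw [← hμs, ← hνt, h])⟩
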